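/- **Corollary (convergence in $L_1$).** Let $\|\cdot\|$ be a norm on $\mathbb{R}^d$, $L\in\mathbb{R}$ and $\kappa>0$. For $t\ge 1$ put $\Delta=\kappa\, t^{-1/(d+2)}$. Let $\pi$ be a function on $[0,1]^d$ with $|\pi(x)-\pi(y)|\le L\|x-y\|$ for all $x,y$. Write $\mathrm{Beta}(\alpha,\beta)$ for the Beta distribution, and for $0\le B<1$ and integers $0\le s\le n$ let $$P_B(n,s)=\sum_{i=0}^{s} C_i\,\mathrm{Beta}(1+i,\,1+n-i),\qquad C_i\propto\binom{s}{i}\, i!\,(n-i)!\,B^{s-i},\quad \sum_{i=0}^{s} C_i=1$$ (with $0^0=1$), the Bayesian posterior of a uniformly distributed $\theta$ after $s$ successes in $n$ independent $\mathrm{Bernoulli}((1-B)\theta+B)$ tests. In each setting below the experiments $i=1,\dots,t$ are independent, the points $x_i$ are uniformly distributed on $[0,1]^d$, $s_i\in\{0,1\}$ is the outcome of experiment $i$, and the prior at every point is uniform, i.e. $\mathrm{Beta}(1,1)$. For a query point $x$, let $\mathcal{S}_x=\{i:\|x-x_i\|\le\Delta\}$, $n_x=|\mathcal{S}_x|$ and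 $s_x=\sum_{i\in\mathcal{S}_x}s_i$. 1. (Static setting, Smooth Beta Process.) $\pi$ takes values in $[0,1]$; given $x_i$, $s_i\sim\mathrm{Bernoulli}(\pi(x_i))$; the posterior at $x$ is $\tilde\pi(x|\mathcal{S})\sim\mathrm{Beta}(1+s_x,\,1+n_x-s_x)$. 2. (Dynamic setting, constant context.) $\pi$ takes values in $(0,1]$ and $0\le B<1$; given $x_i$, $s_i\sim\mathrm{Bernoulli}((1-B)\pi(x_i)+B)$; the posterior at $x$ is $\tilde\pi(x|\mathcal{S})\sim P_B(n_x,s_x)$. 3. (Dynamic setting, varying noisy context, Contextual Smooth Beta Process.) $\pi$ takes values in $(0,1]$ and $0\le B_i\le b<1$ for $i=1,\dots,t$. The noises $\epsilon_i$ are independent of each other and of the points, with mean $0$ and variance $\sigma^2$, and such that almost surely $(1-(B_i+\epsilon_i))\pi(y)+B_i+\epsilon_i\in[0,1]$ for all $y\in[0,1]^d$. Given $x_i$ and $\epsilon_i$, $s_i\sim\mathrm{Bernoulli}((1-(B_i+\epsilon_i))\pi(x_i)+B_i+\epsilon_i)$. The posterior at $x$ is $\tilde\pi(x|\mathcal{S})\sim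 P_{\bar B}(n_x,s_x)$ with $\bar B=\frac{1}{n_x}\sum_{i\in\mathcal{S}_x}B_i$ (and it is the uniform prior if $n_x=0$). Then in each of the three settings there is a constant $C$ such that for all such $\pi$ and all $t\ge1$ $$\sup_{x\in[0,1]^d}\mathbb{E}_{\mathcal{S}}\,\mathbb{E}\,|\tilde\pi(x|\mathcal{S})-\pi(x)|\le C\,t^{-\frac{1}{d+2}},$$ where the inner expectation is over the posterior and the outer one over the experiments (points, noises and outcomes). The constant $C$ depends only on $d$, $\|\cdot\|$, $L$, $\kappa$; in setting 2 also on $B$; in setting 3 also on $b$ and $\sigma$ (but not otherwise on the $B_i$ or on the laws of the $\epsilon_i$). -/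

import Mathlib

open MeasureTheory ProbabilityTheory
open scoped ENNReal

namespace SmoothBeta

noncomputable section

/-- The feature space `[0,1]^d`; its `volume` is the uniform probability distribution. -/
abbrev Cube (d : ℕ) : Type := Fin d → unitInterval

/-- The distance `N (x - y)` of two points of the cube, for a norm `N` on `ℝ^d`. -/
def normDist {d : ℕ} (N : Seminorm ℝ (Fin d → ℝ)) (x y : Cube d) : ℝ :=
  N (fun j => (x j : ℝ) - (y j : ℝ))

/-- `f` is `L`-Lipschitz on the cube with respect to the norm `N`. -/
def IsLipschitz {d : ℕ} (N : Seminorm ℝ (Fin d → ℝ)) (L : ℝ) (f : Cube d → ℝ) : Prop :=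
  ∀ x y, |f x - f y| ≤ L * normDist N x y

/-! ### The laws of the experiments -/

/-- The mass function of the Bernoulli distribution with parameter `p`
(`true` is a success, `false` a failure). -/
def bernoulliMass (p : ℝ) (s : Bool) : ℝ≥0∞ :=
  ENNReal.ofReal (if s then p else 1 - p)

/-- The joint law of a pair `(z, s)`, where `z` has law `ζ` and, given `z`, the outcome `s` is
Bernoulli with parameter `p z`. -/
def testLaw {Z : Type*} [MeasurableSpace Z] (ζ : Measure Z) (p : Z → ℝ) : Measure (Z × Bool) :=
  (ζ.prod Measure.count).withDensity (fun w => bernoulliMass (p w.1) w.2)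

/-- The law of `t` independent static experiments `(xᵢ, sᵢ)`: `xᵢ` uniform on the cube and
`sᵢ ∼ Bernoulli (f xᵢ)`. -/
def staticLaw {d : ℕ} (f : Cube d → ℝ) (t : ℕ) : Measure (Fin t → Cube d × Bool) :=
  Measure.pi fun _ => testLaw volume f

/-- The law of `t` independent experiments `(xᵢ, sᵢ)` with constant contextual parameters
`(1 - B, B)`: `xᵢ` uniform on the cube and `sᵢ ∼ Bernoulli ((1 - B) f xᵢ + B)`. -/
def contextLaw {d : ℕ} (f : Cube d → ℝ) (B : ℝ) (t : ℕ) : Measure (Fin t → Cube d × Bool) :=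
  Measure.pi fun _ => testLaw volume fun x => (1 - B) * f x + B

/-- The success probability `(1 - (b + e)) f x + b + e` of a test at `x` whose contextual
parameter is believed to be `b` and is `b + e` in reality. -/
def noisyParam {d : ℕ} (f : Cube d → ℝ) (b e : ℝ) (x : Cube d) : ℝ :=
  (1 - (b + e)) * f x + b + e

/-- The law of `t` independent noisy experiments `((xᵢ, εᵢ), sᵢ)`: `xᵢ` is uniform on the cube,
the noise `εᵢ` has law `ρ i` and is independent of `xᵢ`, and given both,
`sᵢ ∼ Bernoulli ((1 - (Bᵢ + εᵢ)) f xᵢ + Bᵢ + εᵢ)`. -/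
def noisyLaw {d : ℕ} (f : Cube d → ℝ) {t : ℕ} (B : Fin t → ℝ) (ρ : Fin t → Measure ℝ) :
    Measure (Fin t → (Cube d × ℝ) × Bool) :=
  Measure.pi fun i =>
    testLaw ((volume : Measure (Cube d)).prod (ρ i)) fun z => noisyParam f (B i) z.2 z.1

/-! ### The algorithms

Each takes the proportionality constant `κ` of the kernel width, the prior parameters `α, β`,
the experiments and the query point `x`, and returns the posterior distribution at `x`. -/

/-- The kernel width `Δ = κ t^(-1/(d+2))`. -/
def kernelWidth (κ : ℝ) (d t : ℕ) : ℝ :=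
  κ * (t : ℝ) ^ (-(1 / ((d : ℝ) + 2)))

/-- The indices of the experiments performed at distance at most `Δ` of `x`. -/
def neighbours {d t : ℕ} (N : Seminorm ℝ (Fin d → ℝ)) (Δ : ℝ) (X : Fin t → Cube d)
    (x : Cube d) : Finset (Fin t) :=
  {i | normDist N x (X i) ≤ Δ}

/-- The sharing kernel `K(x, y) = 1` if `‖x - y‖ ≤ Δ`, and `0` otherwise. -/
def sharingKernel {d : ℕ} (N : Seminorm ℝ (Fin d → ℝ)) (Δ : ℝ) (x y : Cube d) : ℝ :=
  if normDist N x y ≤ Δ then 1 else 0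

/-- Smooth Beta Process: the posterior is
`Beta (α x + ∑_{sᵢ = 1} K(x, xᵢ), β x + ∑_{sᵢ = 0} K(x, xᵢ))`. -/
def smoothBetaProcess {d t : ℕ} (N : Seminorm ℝ (Fin d → ℝ)) (κ : ℝ) (α β : Cube d → ℝ)
    (S : Fin t → Cube d × Bool) (x : Cube d) : Measure ℝ :=
  betaMeasure
    (α x + ∑ i, if (S i).2 = true then sharingKernel N (kernelWidth κ d t) x (S i).1 else 0)
    (β x + ∑ i, if (S i).2 = false then sharingKernel N (kernelWidth κ d t) x (S i).1 else 0)

/-- The unnormalized coefficient `binom(s, i) (α-1+i)! (β+n-1-i)! B^(s-i)` of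
`Beta (α + i, β + n - i)` in the posterior after `s` successes in `n` tests with parameters
`(1 - B, B)`, where `(r - 1)!` is read as `Γ(r)`. -/
def mixtureWeight (α β B : ℝ) (n s i : ℕ) : ℝ :=
  (s.choose i : ℝ) * Real.Gamma (α + i) * Real.Gamma (β + n - i) * B ^ (s - i)

/-- The Bayesian posterior `∑_{i ≤ s} Cᵢ Beta (α + i, β + n - i)`, with `Cᵢ` proportional to
`mixtureWeight α β B n s i` and `∑ Cᵢ = 1`, obtained from the prior `Beta (α, β)` after observing
`s` successes in `n` tests, all with contextual parameters `(1 - B, B)`. -/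
def contextPosterior (α β B : ℝ) (n s : ℕ) : Measure ℝ :=
  ∑ i ∈ Finset.range (s + 1),
    ENNReal.ofReal
        (mixtureWeight α β B n s i / ∑ j ∈ Finset.range (s + 1), mixtureWeight α β B n s j) •
      betaMeasure (α + i) (β + n - i)

/-- The inference engine for constant contextual parameters `(1 - B, B)`: the Bayesian posterior
of the neighbouring experiments, as if they had all been performed at `x`. -/
def constantContextProcess {d t : ℕ} (N : Seminorm ℝ (Fin d → ℝ)) (κ : ℝ) (α β : Cube d → ℝ)
    (B : ℝ) (S : Fin t → Cube d × Bool) (x : Cube d) : Measure ℝ :=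
  let Sx := neighbours N (kernelWidth κ d t) (fun i => (S i).1) x
  contextPosterior (α x) (β x) B Sx.card (Sx.filter fun i => (S i).2 = true).card

/-- Contextual Smooth Beta Process, for contextual parameters `(1 - Bᵢ, Bᵢ)`: as before, with
the constant parameters `(1 - B, B)`, where `B` is the mean of the `Bᵢ` over the neighbouring
experiments (so that `1 - B` is the mean of the `1 - Bᵢ`). Without neighbours the
posterior is the prior, whatever the value of `B`. -/
def contextualSmoothBetaProcess {d t : ℕ} (N : Seminorm ℝ (Fin d → ℝ)) (κ : ℝ)
    (α β : Cube d → ℝ) (B : Fin t → ℝ) (S : Fin t → Cube d × Bool) (x : Cube d) : Measure ℝ :=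
  let Sx := neighbours N (kernelWidth κ d t) (fun i => (S i).1) x
  contextPosterior (α x) (β x) ((∑ i ∈ Sx, B i) / Sx.card) Sx.card
    (Sx.filter fun i => (S i).2 = true).card

/-- `E |θ - p|`, for `θ` distributed according to `post`. -/
def l1Error (post : Measure ℝ) (p : ℝ) : ℝ≥0∞ :=
  ∫⁻ θ, ENNReal.ofReal |θ - p| ∂post

end

end SmoothBeta

namespace SmoothBeta

/-! Write q(θ) = (1 - B)θ + B. Up to normalization the posterior with uniform prior has density
q(θ)^s (1 - θ)^(n-s) on [0, 1] (`lintegral_contextPosterior`), and integrating a well-chosen total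
derivative shows that q has second moment at most 1/(4(n+2)) about max((s+1)/(n+2), B)
(`integral_sq_sub_posteriorCenter_le`). Since θ - p = (q(θ) - q(p))/(1 - B), the L₁ error is
controlled, through E|Z| ≤ (1/r + r E Z²)/2, by 1/(n+2) and the squared distance of (s+1)/(n+2) from
q(p).

That distance splits into a bias of order |L|Δ from using neighbours within Δ, a fluctuation z/(n+2)
with z the centred number of successes, and a term of order 1/(n+2). Averaging the Bᵢ costs nothing
because q is affine in B. The random denominator is replaced by its mean μ = t·vol{y : ‖x - y‖ ≤ Δ}
at the price of a multiple of (n - μ)²/μ² (`posterior_sq_error_le`). By independence both (n - μ)²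
and z² have expectation at most μ (`integral_sq_counts_le`), so the mean squared error is O(1/μ +
Δ²). Mean-zero noise enters the success probability linearly and leaves its mean given the point
unchanged.

With r = t^(1/(d+2)) one has Δ = κ/r and μ ≥ c r², because such a ball has volume at least c r^(-d)
even at the boundary of the cube. Hence the error is O(1/r + r·r⁻²) = O(1/r). The static process is
the case B = 0. -/

/-! ### The posterior as a normalized likelihood -/

/-- The success probability `(1 - B) θ + B` at contextual parameters `(1 - B, B)`. -/
noncomputable def successProb (B θ : ℝ) : ℝ := (1 - B) * θ + B

/-- The likelihood of `s` successes in `n` tests with contextual parameters `(1 - B, B)`. -/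
noncomputable def likelihood (B : ℝ) (n s : ℕ) (θ : ℝ) : ℝ :=
  successProb B θ ^ s * (1 - θ) ^ (n - s)

lemma continuous_likelihood (B : ℝ) (n s : ℕ) : Continuous (likelihood B n s) := by
  unfold likelihood successProb; fun_prop

lemma likelihood_nonneg {B : ℝ} (hB : 0 ≤ B) (hB1 : B < 1) (n s : ℕ) {θ : ℝ}
    (hθ : θ ∈ Set.Icc (0 : ℝ) 1) : 0 ≤ likelihood B n s θ := by
  have h : 0 ≤ successProb B θ := by
    unfold successProb
    have := mul_nonneg (sub_nonneg.2 hB1.le) hθ.1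
    linarith
  exact mul_nonneg (pow_nonneg h _) (pow_nonneg (sub_nonneg.2 hθ.2) _)

lemma integral_likelihood_pos {B : ℝ} (hB : 0 ≤ B) (hB1 : B < 1) (n s : ℕ) :
    0 < ∫ θ in (0 : ℝ)..1, likelihood B n s θ := by
  refine intervalIntegral.intervalIntegral_pos_of_pos_on
    ((continuous_likelihood B n s).intervalIntegrable _ _) (fun θ hθ => ?_) one_pos
  have h : 0 < successProb B θ := by
    unfold successProb
    have := mul_pos (sub_pos.2 hB1) hθ.1
    linarith
  exact mul_pos (pow_pos h _) (pow_pos (sub_pos.2 hθ.2) _)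

lemma lintegral_betaMeasure (i k : ℕ) {g : ℝ → ℝ} (hg : Continuous g) (hg0 : ∀ θ, 0 ≤ g θ) :
    ∫⁻ θ, ENNReal.ofReal (g θ) ∂(betaMeasure (1 + i) (1 + k)) =
      ENNReal.ofReal ((∫ θ in (0 : ℝ)..1, g θ * (θ ^ i * (1 - θ) ^ k)) / beta (1 + i) (1 + k)) := by
  have hpos : 0 < beta (1 + i) (1 + k) := beta_pos (by positivity) (by positivity)
  rw [betaMeasure, lintegral_withDensity_eq_lintegral_mul _
    (by unfold betaPDF; fun_prop) (by fun_prop), intervalIntegral.integral_of_le zero_le_one,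
    integral_Ioc_eq_integral_Ioo, ← integral_div,
    ofReal_integral_eq_lintegral_ofReal, ← lintegral_indicator measurableSet_Ioo]
  · congr 1 with θ
    by_cases hθ : 0 < θ ∧ θ < 1
    · rw [Set.indicator_of_mem (by exact hθ), Pi.mul_apply, betaPDF_of_pos_lt_one hθ.1 hθ.2,
        mul_comm, ← ENNReal.ofReal_mul (hg0 _)]
      congr 1
      rw [add_sub_cancel_left, add_sub_cancel_left, Real.rpow_natCast, Real.rpow_natCast]
      ring
    · rw [Set.indicator_of_notMem (by exact hθ), Pi.mul_apply, betaPDF_eq, if_neg hθ]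
      simp
  · exact (Continuous.integrableOn_Icc (by fun_prop)).mono_set Set.Ioo_subset_Icc_self
  · refine ae_restrict_of_forall_mem measurableSet_Ioo fun θ hθ => ?_
    exact div_nonneg (mul_nonneg (hg0 _) (mul_nonneg (pow_nonneg hθ.1.le _)
      (pow_nonneg (sub_nonneg.2 hθ.2.le) _))) hpos.le

/-- Read off from the total mass 1 of the Beta distribution, by testing it against g = 1. -/
lemma integral_pow_mul_one_sub_pow (i k : ℕ) :
    ∫ θ in (0 : ℝ)..1, θ ^ i * (1 - θ) ^ k = beta (1 + i) (1 + k) := by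
  have hpos : 0 < beta (1 + i) (1 + k) := beta_pos (by positivity) (by positivity)
  have h := lintegral_betaMeasure i k (g := fun _ => 1) continuous_const (fun _ => zero_le_one)
  have := isProbabilityMeasureBeta (α := 1 + i) (β := 1 + k) (by positivity) (by positivity)
  simp only [ENNReal.ofReal_one, lintegral_const, measure_univ, mul_one, one_mul] at h
  have h' := (ENNReal.ofReal_eq_one.1 h.symm)
  rwa [div_eq_one_iff_eq hpos.ne'] at h'

/-- Binomial expansion of q^s with q = θ + B(1 - θ). This produces the mixture of Beta densities. -/
lemma likelihood_eq_sum (B : ℝ) {n s : ℕ} (hs : s ≤ n) (θ : ℝ) :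
    likelihood B n s θ =
      ∑ i ∈ Finset.range (s + 1), s.choose i * B ^ (s - i) * (θ ^ i * (1 - θ) ^ (n - i)) := by
  have h : successProb B θ = θ + B * (1 - θ) := by unfold successProb; ring
  rw [likelihood, h, add_pow, Finset.sum_mul]
  refine Finset.sum_congr rfl fun i hi => ?_
  have : n - i = (s - i) + (n - s) := by
    have := Finset.mem_range.1 hi
    omega
  rw [this, pow_add, mul_pow]
  ring

/-- The two Gamma factors are a Beta integral times Γ(n + 2). The latter does not depend on i and
cancels on normalization. -/
lemma mixtureWeight_one_one (B : ℝ) {n s i : ℕ} (hs : s ≤ n) (hi : i ∈ Finset.range (s + 1)) :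
    mixtureWeight 1 1 B n s i =
      Real.Gamma (n + 2) * (s.choose i * B ^ (s - i) * beta (1 + i) (1 + (n - i : ℕ))) := by
  have hin : i ≤ n := by
    have := Finset.mem_range.1 hi
    omega
  have hG : Real.Gamma ((n : ℝ) + 2) ≠ 0 := (Real.Gamma_pos_of_pos (by positivity)).ne'
  have : (1 : ℝ) + i + (1 + (n - i)) = n + 2 := by ring
  rw [mixtureWeight, beta, Nat.cast_sub hin, this, add_sub_assoc]
  field_simp

lemma sum_mixtureWeight (B : ℝ) {n s : ℕ} (hs : s ≤ n) :
    ∑ i ∈ Finset.range (s + 1), mixtureWeight 1 1 B n s i =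
      Real.Gamma (n + 2) * ∫ θ in (0 : ℝ)..1, likelihood B n s θ := by
  simp_rw [likelihood_eq_sum B hs]
  rw [intervalIntegral.integral_finsetSum
    fun i _ => Continuous.intervalIntegrable (by fun_prop) _ _, Finset.mul_sum]
  refine Finset.sum_congr rfl fun i hi => ?_
  rw [mixtureWeight_one_one B hs hi, intervalIntegral.integral_const_mul,
    integral_pow_mul_one_sub_pow]

/-- The Beta normalizations cancel against the weights, and the binomial sum reassembles into the
likelihood. The factor (1 - B)^(n-s) of the Bernoulli likelihood is constant in θ and so may be
missing from `likelihood`. -/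
lemma lintegral_contextPosterior {B : ℝ} (hB : 0 ≤ B) (hB1 : B < 1) {n s : ℕ} (hs : s ≤ n)
    {g : ℝ → ℝ} (hg : Continuous g) (hg0 : ∀ θ, 0 ≤ g θ) :
    ∫⁻ θ, ENNReal.ofReal (g θ) ∂(contextPosterior 1 1 B n s) =
      ENNReal.ofReal ((∫ θ in (0 : ℝ)..1, g θ * likelihood B n s θ) /
        ∫ θ in (0 : ℝ)..1, likelihood B n s θ) := by
  have hW := integral_likelihood_pos hB hB1 n s
  have hG : 0 < Real.Gamma ((n : ℝ) + 2) := Real.Gamma_pos_of_pos (by positivity)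
  have hint (i k : ℕ) : 0 ≤ ∫ θ in (0 : ℝ)..1, g θ * (θ ^ i * (1 - θ) ^ k) :=
    intervalIntegral.integral_nonneg zero_le_one fun θ hθ => mul_nonneg (hg0 _)
      (mul_nonneg (pow_nonneg hθ.1 _) (pow_nonneg (sub_nonneg.2 hθ.2) _))
  have hterm : ∀ i ∈ Finset.range (s + 1),
      ENNReal.ofReal (mixtureWeight 1 1 B n s i /
          ∑ j ∈ Finset.range (s + 1), mixtureWeight 1 1 B n s j) *
        ∫⁻ θ, ENNReal.ofReal (g θ) ∂(betaMeasure (1 + i) (1 + n - i)) =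
      ENNReal.ofReal (s.choose i * B ^ (s - i) *
        (∫ θ in (0 : ℝ)..1, g θ * (θ ^ i * (1 - θ) ^ (n - i))) /
        ∫ θ in (0 : ℝ)..1, likelihood B n s θ) := by
    intro i hi
    have hin : i ≤ n := by
      have := Finset.mem_range.1 hi
      omega
    have hpos : 0 < beta (1 + i) (1 + (n - i : ℕ)) := beta_pos (by positivity) (by positivity)
    have h1 : (1 : ℝ) + n - i = 1 + (n - i : ℕ) := by rw [Nat.cast_sub hin]; ring
    rw [h1, lintegral_betaMeasure _ _ hg hg0, sum_mixtureWeight B hs,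
      mixtureWeight_one_one B hs hi, ← ENNReal.ofReal_mul (by positivity)]
    congr 1
    field_simp
  rw [contextPosterior, lintegral_finsetSum_measure]
  simp_rw [lintegral_smul_measure, smul_eq_mul]
  rw [Finset.sum_congr rfl hterm, ← ENNReal.ofReal_sum_of_nonneg fun i _ =>
    div_nonneg (mul_nonneg (by positivity) (hint _ _)) hW.le, ← Finset.sum_div]
  congr 2
  simp_rw [likelihood_eq_sum B hs, Finset.mul_sum]
  rw [intervalIntegral.integral_finsetSum
    fun i _ => Continuous.intervalIntegrable (by fun_prop) _ _]
  refine Finset.sum_congr rfl fun i _ => ?_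
  rw [← intervalIntegral.integral_const_mul]
  congr 1 with θ
  ring

/-! ### Concentration of the posterior -/

/-- The center of the posterior of the success probability: its mean for the prior that is uniform
on `[0, 1]`, moved into `[B, 1]`. -/
noncomputable def posteriorCenter (B : ℝ) (n s : ℕ) : ℝ :=
  max ((s + 1) / (n + 2)) B

/-- Integration by parts, as for the variance of a Beta law, except that θ = 0 corresponds to q = B
and leaves a boundary term. Moving the centre up to at least B gives this term a favourable sign. -/
lemma integral_sq_sub_posteriorCenter_le {B : ℝ} (hB : 0 ≤ B) (hB1 : B < 1) {n s : ℕ}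
    (hs : s ≤ n) :
    ∫ θ in (0 : ℝ)..1, (successProb B θ - posteriorCenter B n s) ^ 2 * likelihood B n s θ ≤
      (1 / (4 * (n + 2))) * ∫ θ in (0 : ℝ)..1, likelihood B n s θ := by
  set c := posteriorCenter B n s with hc
  set m : ℝ := (s + 1) / (n + 2) with hm
  have hmc : m ≤ c := le_max_left _ _
  have hBc : B ≤ c := le_max_right _ _
  have hn : (0 : ℝ) < n + 2 := by positivity
  obtain ⟨k, rfl⟩ := Nat.exists_eq_add_of_le hs
  -- One extra power of q and of 1 - θ makes the likelihood factor out of the derivative. It uses 1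
  -- - q = (1 - B)(1 - θ) and (k+1)q - (s+1)(1-q) = (n+2)(q - m), where n = s + k.
  have hderiv : ∀ θ ∈ Set.uIcc (0 : ℝ) 1, HasDerivAt
      (fun θ => (successProb B θ - c) * (successProb B θ ^ (s + 1) * (1 - θ) ^ (k + 1)))
      ((successProb B θ * (1 - successProb B θ) -
        ((s + k : ℕ) + 2) * ((successProb B θ - c) * (successProb B θ - m))) *
          likelihood B (s + k) s θ) θ := by
    intro θ _
    have hq : HasDerivAt (successProb B) (1 - B) θ := 
      (((hasDerivAt_id' θ).const_mul (1 - B)).add_const B).congr_deriv (mul_one _)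
    have h1 : HasDerivAt (fun θ : ℝ => 1 - θ) (-1) θ := by
      simpa using (hasDerivAt_id θ).const_sub 1
    have h := (hq.sub_const c).mul ((hq.pow (s + 1)).mul (h1.pow (k + 1)))
    refine h.congr_deriv ?_
    have h2 : 1 - successProb B θ = (1 - B) * (1 - θ) := by unfold successProb; ring
    have h3 : ((s + k : ℕ) + 2) * (successProb B θ - m) =
        (k + 1) * successProb B θ - (s + 1) * (1 - successProb B θ) := by
      rw [hm]; field_simp; push_cast; ring
    have h4 : successProb B θ * (1 - successProb B θ) -
        ((s + k : ℕ) + 2) * ((successProb B θ - c) * (successProb B θ - m)) =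
        successProb B θ * (1 - successProb B θ) - (successProb B θ - c) *
          ((k + 1) * successProb B θ - (s + 1) * (1 - successProb B θ)) := by
      rw [← h3]; ring
    rw [h4, h2, likelihood, Nat.add_sub_cancel_left]
    simp only [Pi.mul_apply, Pi.pow_apply, Nat.add_sub_cancel, pow_succ, Nat.cast_add,
      Nat.cast_one]
    ring
  have hsc : Continuous (successProb B) := by unfold successProb; fun_prop
  have hlc := continuous_likelihood B (s + k) s
  have hftc := intervalIntegral.integral_eq_sub_of_hasDerivAt hderiv
    (Continuous.intervalIntegrable (by fun_prop) _ _)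
  have hnonneg : 0 ≤ ∫ θ in (0 : ℝ)..1, (successProb B θ * (1 - successProb B θ) -
        ((s + k : ℕ) + 2) * ((successProb B θ - c) * (successProb B θ - m))) *
          likelihood B (s + k) s θ := by
    rw [hftc]
    -- The boundary term at θ = 1 vanishes; at θ = 0 it contributes -(B - c)B^(s+1), which is
    -- nonnegative as c ≥ B.
    have : (B - c) * B ^ (s + 1) ≤ 0 :=
      mul_nonpos_of_nonpos_of_nonneg (sub_nonpos.2 hBc) (pow_nonneg hB _)
    simpa [successProb] using this
  have hle : ∫ θ in (0 : ℝ)..1, (successProb B θ * (1 - successProb B θ) -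
        ((s + k : ℕ) + 2) * ((successProb B θ - c) * (successProb B θ - m))) *
          likelihood B (s + k) s θ ≤
      ∫ θ in (0 : ℝ)..1, ((1 / 4) * likelihood B (s + k) s θ - ((s + k : ℕ) + 2) *
        ((successProb B θ - c) ^ 2 * likelihood B (s + k) s θ)) := by
    refine intervalIntegral.integral_mono_on zero_le_one
      (Continuous.intervalIntegrable (by fun_prop) _ _)
      (Continuous.intervalIntegrable (by fun_prop) _ _) fun θ hθ => ?_
    have hq : B ≤ successProb B θ := by
      have := mul_nonneg (sub_nonneg.2 hB1.le) hθ.1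
      unfold successProb
      linarith
    have h1 : (successProb B θ - c) ^ 2 ≤ (successProb B θ - c) * (successProb B θ - m) := by
      -- Either c = m, or c = B, and then both factors are nonnegative.
      have : 0 ≤ (successProb B θ - c) * (c - m) := by
        rcases le_total m B with h | h
        · have : c = B := max_eq_right h
          exact mul_nonneg (by linarith) (by linarith)
        · have : c = m := max_eq_left h
          simp [this]
      nlinarith
    have h2 : successProb B θ * (1 - successProb B θ) ≤ 1 / 4 := by
      nlinarith [sq_nonneg (successProb B θ - 1 / 2)]
    have h3 := mul_le_mul_of_nonneg_left h1 hn.le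
    have h4 := likelihood_nonneg hB hB1 (s + k) s hθ
    calc _ ≤ (1 / 4 - ((s + k : ℕ) + 2) * (successProb B θ - c) ^ 2) *
          likelihood B (s + k) s θ := mul_le_mul_of_nonneg_right (by linarith) h4
      _ = _ := by ring
  rw [intervalIntegral.integral_sub (Continuous.intervalIntegrable (by fun_prop) _ _)
    (Continuous.intervalIntegrable (by fun_prop) _ _), intervalIntegral.integral_const_mul,
    intervalIntegral.integral_const_mul] at hle
  rw [one_div, mul_inv, mul_assoc, ← one_div (4 : ℝ), mul_left_comm, ← div_eq_inv_mul,
    le_div_iff₀ hn]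
  linarith

/-- Bound of the `L₁` error of the posterior by means of `E |Z| ≤ (1/r + r E Z²) / 2`. -/
lemma l1Error_contextPosterior_le {B b : ℝ} (hB : 0 ≤ B) (hBb : B ≤ b) (hb : b < 1) {n s : ℕ}
    (hs : s ≤ n) {p : ℝ} (hp : p ∈ Set.Icc (0 : ℝ) 1) {r : ℝ} (hr : 0 < r) :
    l1Error (contextPosterior 1 1 B n s) p ≤
      ENNReal.ofReal ((1 / r + r * ((1 - b)⁻¹ ^ 2 *
        (1 / (2 * (n + 2)) + 2 * ((s + 1) / (n + 2) - successProb B p) ^ 2))) / 2) := by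
  have hB1 : B < 1 := hBb.trans_lt hb
  have hW := integral_likelihood_pos hB hB1 n s
  set W := ∫ θ in (0 : ℝ)..1, likelihood B n s θ with hWdef
  have hlc := continuous_likelihood B n s
  have hsc : Continuous (successProb B) := by unfold successProb; fun_prop
  rw [l1Error, lintegral_contextPosterior hB hB1 hs (by fun_prop) fun θ => abs_nonneg _]
  refine ENNReal.ofReal_le_ofReal ?_
  rw [div_le_iff₀ hW]
  set c := posteriorCenter B n s with hc
  set D : ℝ := ((s + 1) / (n + 2) - successProb B p) ^ 2 with hD
  have hqp : B ≤ successProb B p := by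
    have := mul_nonneg (sub_nonneg.2 hB1.le) hp.1
    unfold successProb
    linarith
  -- Replacing m by max(m, B) does not increase its distance to a point that is at least B.
  have hcp : (c - successProb B p) ^ 2 ≤ D := by
    rw [hD, sq_le_sq]
    rcases le_total ((s + 1 : ℝ) / (n + 2)) B with h | h
    · have : c = B := max_eq_right h
      rw [this, abs_of_nonpos (by linarith), abs_of_nonpos (by linarith)]
      linarith
    · have : c = (s + 1) / (n + 2) := max_eq_left h
      rw [this]
  have hinv : 0 < (1 - b)⁻¹ := inv_pos.2 (by linarith)
  have hpt : ∀ θ ∈ Set.Icc (0 : ℝ) 1, |θ - p| * likelihood B n s θ ≤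
      ((1 / r + r * ((1 - b)⁻¹ ^ 2 * (2 * D))) / 2) * likelihood B n s θ +
      (r * (1 - b)⁻¹ ^ 2) * ((successProb B θ - c) ^ 2 * likelihood B n s θ) := by
    intro θ hθ
    have h4 := likelihood_nonneg hB hB1 n s hθ
    have h1 : (θ - p) ^ 2 ≤ (1 - b)⁻¹ ^ 2 * (successProb B θ - successProb B p) ^ 2 := by
      have : successProb B θ - successProb B p = (1 - B) * (θ - p) := by
        unfold successProb; ring
      rw [this, mul_pow, ← mul_assoc, ← mul_pow]
      refine le_mul_of_one_le_left (sq_nonneg _) (one_le_pow₀ ?_)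
      rw [inv_mul_eq_div, one_le_div (by linarith)]
      linarith
    have h2 : (successProb B θ - successProb B p) ^ 2 ≤
        2 * (successProb B θ - c) ^ 2 + 2 * D := by
      nlinarith [sq_nonneg (successProb B θ - c - (c - successProb B p))]
    have h3 : |θ - p| ≤ (1 / r + r * (θ - p) ^ 2) / 2 := by
      rw [← sq_abs (θ - p)]
      have : 0 ≤ (1 - r * |θ - p|) ^ 2 / r := by positivity
      have h5 : (1 - r * |θ - p|) ^ 2 / r = 1 / r + r * |θ - p| ^ 2 - 2 * |θ - p| := by
        field_simp; ring
      linarith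
    have h5 : (θ - p) ^ 2 ≤ (1 - b)⁻¹ ^ 2 * (2 * (successProb B θ - c) ^ 2 + 2 * D) :=
      h1.trans (mul_le_mul_of_nonneg_left h2 (sq_nonneg _))
    have h6 := mul_le_mul_of_nonneg_left h5 hr.le
    calc _ ≤ ((1 / r + r * ((1 - b)⁻¹ ^ 2 * (2 * (successProb B θ - c) ^ 2 + 2 * D))) / 2) *
          likelihood B n s θ := mul_le_mul_of_nonneg_right (by linarith) h4
      _ = _ := by ring
  have hmono := intervalIntegral.integral_mono_on (μ := volume) zero_le_one
    (Continuous.intervalIntegrable (by fun_prop) _ _)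
    (Continuous.intervalIntegrable (by fun_prop) _ _) hpt
  rw [intervalIntegral.integral_add (Continuous.intervalIntegrable (by fun_prop) _ _)
    (Continuous.intervalIntegrable (by fun_prop) _ _), intervalIntegral.integral_const_mul,
    intervalIntegral.integral_const_mul, ← hWdef] at hmono
  have h7 := mul_le_mul_of_nonneg_left (integral_sq_sub_posteriorCenter_le hB hB1 hs)
    (by positivity : 0 ≤ r * (1 - b)⁻¹ ^ 2)
  refine (hmono.trans (add_le_add_right h7 _)).trans_eq ?_
  rw [← hWdef]
  have hn : ((n : ℝ) + 2) ≠ 0 := by positivity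
  field_simp
  ring

/-! ### Balls of the norm in the cube -/

lemma exists_normDist_le {d : ℕ} (N : Seminorm ℝ (Fin d → ℝ)) :
    ∃ M : ℝ, 0 < M ∧ ∀ x y : Cube d, normDist N x y ≤ M * dist x y := by
  have hN : Continuous N :=
    continuousOn_univ.1 (ConvexOn.continuousOn isOpen_univ N.convexOn)
  obtain ⟨M, hM, h⟩ := N.bound_of_continuous_normedSpace hN
  refine ⟨M, hM, fun x y => (h _).trans (mul_le_mul_of_nonneg_left ?_ hM.le)⟩
  exact (pi_norm_le_iff_of_nonneg dist_nonneg).2 fun j => dist_le_pi_dist x y j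

lemma normDist_nonneg {d : ℕ} (N : Seminorm ℝ (Fin d → ℝ)) (x y : Cube d) :
    0 ≤ normDist N x y := apply_nonneg N _

lemma continuous_normDist {d : ℕ} (N : Seminorm ℝ (Fin d → ℝ)) (x : Cube d) :
    Continuous (normDist N x) := by
  have hN : Continuous N :=
    continuousOn_univ.1 (ConvexOn.continuousOn isOpen_univ N.convexOn)
  unfold normDist
  fun_prop

lemma measurableSet_normDist_le {d : ℕ} (N : Seminorm ℝ (Fin d → ℝ)) (x : Cube d) (Δ : ℝ) :
    MeasurableSet {y | normDist N x y ≤ Δ} :=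
  (isClosed_le (continuous_normDist N x) continuous_const).measurableSet

lemma IsLipschitz.continuous {d : ℕ} {N : Seminorm ℝ (Fin d → ℝ)} {L : ℝ} {f : Cube d → ℝ}
    (hf : IsLipschitz N L f) : Continuous f := by
  obtain ⟨M, hM, h⟩ := exists_normDist_le N
  refine (LipschitzWith.of_dist_le_mul (K := (|L| * M).toNNReal) fun x y => ?_).continuous
  rw [Real.coe_toNNReal _ (by positivity), mul_assoc, Real.dist_eq]
  calc |f x - f y| ≤ L * normDist N x y := hf x y
    _ ≤ |L| * normDist N x y :=
      mul_le_mul_of_nonneg_right (le_abs_self L) (normDist_nonneg N x y)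
    _ ≤ _ := mul_le_mul_of_nonneg_left (h x y) (abs_nonneg L)

/-- At least one of the intervals [a - r, a] and [0, r] lies in both [0, 1] and the ball, also when
a is near an endpoint. -/
lemma ofReal_le_volume_closedBall (a : unitInterval) {r : ℝ} (hr : 0 ≤ r) (hr1 : r ≤ 1) :
    ENNReal.ofReal r ≤ volume (Metric.closedBall a r) := by
  rcases le_total r a with h | h
  · have hmem : (a : ℝ) - r ∈ Set.Icc (0 : ℝ) 1 := ⟨by linarith, by linarith [a.2.2]⟩
    calc ENNReal.ofReal r = volume (Set.Icc ⟨a - r, hmem⟩ a) := by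
          rw [unitInterval.volume_Icc]; simp
      _ ≤ _ := measure_mono fun y hy => by
          rw [Metric.mem_closedBall, Subtype.dist_eq, Real.dist_eq, abs_le]
          have h1 : (a : ℝ) - r ≤ y := hy.1
          have h2 : (y : ℝ) ≤ a := hy.2
          constructor <;> linarith
  · calc ENNReal.ofReal r = volume (Set.Icc 0 (⟨r, hr, hr1⟩ : unitInterval)) := by
          rw [unitInterval.volume_Icc]; simp
      _ ≤ _ := measure_mono fun y hy => by
          rw [Metric.mem_closedBall, Subtype.dist_eq, Real.dist_eq, abs_le]
          have h1 : (0 : ℝ) ≤ y := hy.1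
          have h2 : (y : ℝ) ≤ r := hy.2
          have h3 := a.2.1
          constructor <;> linarith

lemma ofReal_pow_le_volume_closedBall {d : ℕ} (x : Cube d) {r : ℝ} (hr : 0 ≤ r) (hr1 : r ≤ 1) :
    ENNReal.ofReal (r ^ d) ≤ volume (Metric.closedBall x r) := by
  rw [closedBall_pi _ hr, volume_pi_pi, ENNReal.ofReal_pow hr]
  calc ENNReal.ofReal r ^ d = ∏ _j : Fin d, ENNReal.ofReal r := by simp
    _ ≤ _ := Finset.prod_le_prod' fun j _ => ofReal_le_volume_closedBall (x j) hr hr1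

/-- The set contains the sup-norm ball of radius Δ/M, whose radius is at most 1 by `hΔM`. -/
lemma pow_le_volume_normDist_le {d : ℕ} {N : Seminorm ℝ (Fin d → ℝ)} {M : ℝ} (hM : 0 < M)
    (hNM : ∀ x y : Cube d, normDist N x y ≤ M * dist x y) (x : Cube d) {Δ : ℝ} (hΔ : 0 ≤ Δ)
    (hΔM : Δ ≤ M) : (Δ / M) ^ d ≤ volume.real {y | normDist N x y ≤ Δ} := by
  have h := ofReal_pow_le_volume_closedBall x (div_nonneg hΔ hM.le) ((div_le_one hM).2 hΔM)
  refine (ENNReal.ofReal_le_iff_le_toReal (measure_ne_top _ _)).1 (h.trans (measure_mono ?_))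
  intro y hy
  rw [Metric.mem_closedBall, dist_comm, le_div_iff₀' hM] at hy
  exact (hNM x y).trans hy

/-! ### Integrals over the laws of the experiments -/

section

variable {Z : Type*} [MeasurableSpace Z] {ζ : Measure Z} [IsProbabilityMeasure ζ] {p : Z → ℝ}

lemma measurable_bernoulliMass (hp : Measurable p) :
    Measurable fun w : Z × Bool => bernoulliMass (p w.1) w.2 := by
  unfold bernoulliMass
  refine ENNReal.measurable_ofReal.comp (Measurable.ite ?_ (by fun_prop) (by fun_prop))
  exact measurable_snd (measurableSet_singleton true)

lemma isProbabilityMeasure_testLaw (hp : Measurable p)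
    (hp01 : ∀ᵐ z ∂ζ, p z ∈ Set.Icc (0 : ℝ) 1) : IsProbabilityMeasure (testLaw ζ p) where
  measure_univ := by
    rw [testLaw, withDensity_apply _ MeasurableSet.univ, setLIntegral_univ,
      lintegral_prod _ (measurable_bernoulliMass hp).aemeasurable]
    have : ∀ᵐ z ∂ζ, ∫⁻ s, bernoulliMass (p z) s ∂Measure.count = 1 := by
      filter_upwards [hp01] with z hz
      rw [lintegral_count, tsum_fintype, Fintype.sum_bool]
      simp only [bernoulliMass, if_true, Bool.false_eq_true, if_false]
      rw [← ENNReal.ofReal_add hz.1 (sub_nonneg.2 hz.2)]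
      simp
    rw [lintegral_congr_ae this]
    simp

lemma integral_testLaw (hp : Measurable p) (hp01 : ∀ᵐ z ∂ζ, p z ∈ Set.Icc (0 : ℝ) 1)
    {g : Z × Bool → ℝ} (hg : Integrable g (testLaw ζ p)) :
    ∫ w, g w ∂(testLaw ζ p) = ∫ z, (p z * g (z, true) + (1 - p z) * g (z, false)) ∂ζ := by
  have hlt : ∀ᵐ w ∂(ζ.prod (Measure.count : Measure Bool)), bernoulliMass (p w.1) w.2 < ⊤ :=
    Filter.Eventually.of_forall fun w => ENNReal.ofReal_lt_top
  rw [testLaw] at hg ⊢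
  rw [integrable_withDensity_iff_integrable_smul' (measurable_bernoulliMass hp) hlt] at hg
  rw [integral_withDensity_eq_integral_toReal_smul (measurable_bernoulliMass hp) hlt,
    integral_prod _ hg]
  refine integral_congr_ae ?_
  filter_upwards [hp01] with z hz
  rw [integral_count, Fintype.sum_bool]
  simp [bernoulliMass, ENNReal.toReal_ofReal hz.1, ENNReal.toReal_ofReal (sub_nonneg.2 hz.2)]

end

/-- Variances of independent variables add, and each is at most the second moment. -/
lemma integral_sq_sum_sub_pi_le {ι : Type*} [Fintype ι] {Ω : ι → Type*}
    [∀ i, MeasurableSpace (Ω i)] (ν : ∀ i, Measure (Ω i)) [∀ i, IsProbabilityMeasure (ν i)]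
    {g : ∀ i, Ω i → ℝ} (hg : ∀ i, MemLp (g i) 2 (ν i)) :
    Integrable (fun ω => (∑ i, g i (ω i) - ∑ i, ∫ w, g i w ∂(ν i)) ^ 2) (Measure.pi ν) ∧
    ∫ ω, (∑ i, g i (ω i) - ∑ i, ∫ w, g i w ∂(ν i)) ^ 2 ∂(Measure.pi ν) ≤
      ∑ i, ∫ w, g i w ^ 2 ∂(ν i) := by
  have hcomp : ∀ i, MemLp (fun ω : ∀ i, Ω i => g i (ω i)) 2 (Measure.pi ν) := fun i =>
    (hg i).comp_measurePreserving (measurePreserving_eval ν i)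
  have hsum : MemLp (∑ i, fun ω : ∀ i, Ω i => g i (ω i)) 2 (Measure.pi ν) :=
    memLp_finsetSum' _ fun i _ => hcomp i
  have hmean : ∫ ω, (∑ i, fun ω : ∀ i, Ω i => g i (ω i)) ω ∂(Measure.pi ν) =
      ∑ i, ∫ w, g i w ∂(ν i) := by
    simp only [Finset.sum_apply]
    rw [integral_finsetSum _ fun i _ => (hcomp i).integrable (by norm_num)]
    exact Finset.sum_congr rfl fun i _ => integral_comp_eval (hg i).aestronglyMeasurable
  have hvar := variance_sum_pi hg
  rw [variance_eq_integral hsum.aemeasurable, hmean] at hvar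
  simp only [Finset.sum_apply] at hvar
  constructor
  · have := (hsum.sub (memLp_const (∑ i, ∫ w, g i w ∂(ν i)))).integrable_sq
    simpa only [Pi.sub_apply, Finset.sum_apply] using this
  · rw [hvar]
    exact Finset.sum_le_sum fun i _ => variance_le_expectation_sq (hg i).aestronglyMeasurable

/-! ### Deterministic error bounds given the counts -/

lemma successProb_mem_Icc {B θ : ℝ} (hB : B ∈ Set.Icc (0 : ℝ) 1) (hθ : θ ∈ Set.Icc (0 : ℝ) 1) :
    successProb B θ ∈ Set.Icc (0 : ℝ) 1 := by
  have h1 := mul_nonneg (sub_nonneg.2 hB.2) hθ.1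
  have h2 := mul_nonneg (sub_nonneg.2 hB.2) (sub_nonneg.2 hθ.2)
  unfold successProb
  constructor <;> linarith [hB.1]

lemma mean_mem_Icc {ι : Type*} (T : Finset ι) {B : ι → ℝ} {b : ℝ} (hb : 0 ≤ b)
    (hB : ∀ i, 0 ≤ B i ∧ B i ≤ b) : (∑ i ∈ T, B i) / T.card ∈ Set.Icc 0 b := by
  refine ⟨div_nonneg (Finset.sum_nonneg fun i _ => (hB i).1) (Nat.cast_nonneg _), ?_⟩
  refine div_le_of_le_mul₀ (Nat.cast_nonneg _) hb ?_
  calc ∑ i ∈ T, B i ≤ ∑ _i ∈ T, b := Finset.sum_le_sum fun i _ => (hB i).2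
    _ = b * T.card := by simp [mul_comm]

/-- As `successProb` is affine in B, n times its value at the mean of the Bᵢ is the sum of its
values at the Bᵢ. What remains is the bias n·a and 1 - 2q, which lies in [-1, 1]. For empty `T` the
mean is 0/0 = 0, which is harmless. -/
lemma abs_sum_successProb_sub_le {ι : Type*} (T : Finset ι) {B : ι → ℝ} {b : ℝ} (hb : 0 ≤ b)
    (hb1 : b < 1) (hB : ∀ i, 0 ≤ B i ∧ B i ≤ b) {u : ι → ℝ} {θ a : ℝ}
    (hθ : θ ∈ Set.Icc (0 : ℝ) 1) (hu : ∀ i ∈ T, |u i - θ| ≤ a) :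
    |∑ i ∈ T, successProb (B i) (u i) + 1 -
      (T.card + 2) * successProb ((∑ i ∈ T, B i) / T.card) θ| ≤ T.card * a + 1 := by
  have hmean := mean_mem_Icc T hb hB
  have hq := successProb_mem_Icc ⟨hmean.1, hmean.2.trans hb1.le⟩ hθ
  set q := successProb ((∑ i ∈ T, B i) / T.card) θ with hqdef
  have hnq : T.card * q = ∑ i ∈ T, successProb (B i) θ := by
    have hcard : (T.card : ℝ) * ((∑ i ∈ T, B i) / T.card) = ∑ i ∈ T, B i := by
      rcases T.eq_empty_or_nonempty with h | h
      · simp [h]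
      · have : (T.card : ℝ) ≠ 0 := Nat.cast_ne_zero.2 h.card_ne_zero
        field_simp
    calc (T.card : ℝ) * q
        = T.card * θ + (T.card * ((∑ i ∈ T, B i) / T.card)) * (1 - θ) := by
          rw [hqdef, successProb]; ring
      _ = ∑ i ∈ T, (θ + B i * (1 - θ)) := by
          rw [hcard, Finset.sum_add_distrib, Finset.sum_mul]; simp
      _ = _ := Finset.sum_congr rfl fun i _ => by unfold successProb; ring
  have hsum : |∑ i ∈ T, (successProb (B i) (u i) - successProb (B i) θ)| ≤ T.card * a := by
    refine (Finset.abs_sum_le_sum_abs _ _).trans ?_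
    rw [← nsmul_eq_mul]
    refine Finset.sum_le_card_nsmul _ _ _ fun i hi => ?_
    have h1 : successProb (B i) (u i) - successProb (B i) θ = (1 - B i) * (u i - θ) := by
      unfold successProb; ring
    have h2 := hB i
    rw [h1, abs_mul, abs_of_nonneg (by linarith)]
    exact (mul_le_of_le_one_left (abs_nonneg _) (by linarith)).trans (hu i hi)
  have hsplit : ∑ i ∈ T, successProb (B i) (u i) + 1 - (T.card + 2) * q =
      ∑ i ∈ T, (successProb (B i) (u i) - successProb (B i) θ) + (1 - 2 * q) := by
    rw [Finset.sum_sub_distrib, ← hnq]; ring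
  rw [hsplit]
  refine (abs_add_le _ _).trans (add_le_add hsum ?_)
  rw [abs_le]
  constructor <;> linarith [hq.1, hq.2]

/-- If n ≥ μ/2, the first term suffices; otherwise (n - μ)² ≥ μ²/4 and the second term is at least
1. The same dichotomy proves `sq_div_sq_le`, where |z| ≤ n handles small n. -/
lemma one_div_add_one_le {μ : ℝ} (hμ : 0 < μ) (n : ℕ) :
    1 / ((n : ℝ) + 1) ≤ 2 / μ + 4 * ((n - μ) ^ 2 / μ ^ 2) := by
  rcases le_total (μ / 2) n with h | h
  · have h1 : 1 / ((n : ℝ) + 1) ≤ 1 / (μ / 2) :=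
      one_div_le_one_div_of_le (by positivity) (by linarith)
    have h2 : 0 ≤ 4 * (((n : ℝ) - μ) ^ 2 / μ ^ 2) := by positivity
    rw [one_div_div] at h1
    linarith
  · have h1 : 1 / ((n : ℝ) + 1) ≤ 1 := by
      rw [div_le_one (by positivity)]
      linarith [n.cast_nonneg (α := ℝ)]
    have h2 : 1 ≤ 4 * (((n : ℝ) - μ) ^ 2 / μ ^ 2) := by
      rw [mul_div_assoc', one_le_div (by positivity)]
      nlinarith
    have h3 : 0 ≤ 2 / μ := by positivity
    linarith

lemma sq_div_sq_le {μ z : ℝ} (hμ : 0 < μ) {n : ℕ} (hz : |z| ≤ n) :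
    z ^ 2 / ((n : ℝ) + 2) ^ 2 ≤ 4 * (z ^ 2 / μ ^ 2) + 4 * ((n - μ) ^ 2 / μ ^ 2) := by
  have hn : (0 : ℝ) ≤ n := n.cast_nonneg
  rcases le_total (μ / 2) n with h | h
  · have h1 : z ^ 2 / ((n : ℝ) + 2) ^ 2 ≤ z ^ 2 / (μ / 2) ^ 2 := by
      gcongr
      linarith
    have h2 : 0 ≤ 4 * (((n : ℝ) - μ) ^ 2 / μ ^ 2) := by positivity
    have h3 : z ^ 2 / (μ / 2) ^ 2 = 4 * (z ^ 2 / μ ^ 2) := by field_simp; ring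
    linarith
  · have h1 : z ^ 2 / ((n : ℝ) + 2) ^ 2 ≤ 1 := by
      rw [div_le_one (by positivity), sq_le_sq, abs_of_nonneg (by positivity : (0 : ℝ) ≤ n + 2)]
      linarith
    have h2 : 1 ≤ 4 * (((n : ℝ) - μ) ^ 2 / μ ^ 2) := by
      rw [mul_div_assoc', one_le_div (by positivity)]
      nlinarith
    have h3 : 0 ≤ 4 * (z ^ 2 / μ ^ 2) := by positivity
    linarith

lemma posterior_sq_error_le {μ z a q : ℝ} (hμ : 0 < μ) (ha : 0 ≤ a) {n s : ℕ} (hz : |z| ≤ n)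
    (h : |s + 1 - (n + 2) * q - z| ≤ n * a + 1) :
    1 / (2 * ((n : ℝ) + 2)) + 2 * ((s + 1) / (n + 2) - q) ^ 2 ≤
      14 / μ + 6 * a ^ 2 + 52 / μ ^ 2 * (n - μ) ^ 2 + 24 / μ ^ 2 * z ^ 2 := by
  have hn : (0 : ℝ) ≤ n := n.cast_nonneg
  have hn2 : (0 : ℝ) < n + 2 := by positivity
  have h1 := one_div_add_one_le hμ n
  have h2 := sq_div_sq_le hμ hz
  have h3 : |(s + 1 : ℝ) / (n + 2) - q| ≤ |z / (n + 2)| + a + 1 / (n + 2) := by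
    have e1 : (s + 1 : ℝ) / (n + 2) - q = z / (n + 2) + (s + 1 - (n + 2) * q - z) / (n + 2) := by
      field_simp; ring
    rw [e1, add_assoc]
    refine (abs_add_le _ _).trans (add_le_add_right ?_ _)
    rw [abs_div, abs_of_pos hn2, div_le_iff₀ hn2, add_mul a, one_div_mul_cancel hn2.ne']
    linarith [mul_comm a n]
  have h4 : ((s + 1 : ℝ) / (n + 2) - q) ^ 2 ≤
      3 * (z ^ 2 / (n + 2) ^ 2) + 3 * a ^ 2 + 3 * (1 / (n + 2)) ^ 2 := by
    rw [← sq_abs, ← div_pow, ← sq_abs (z / (n + 2))]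
    set A := |z / (n + 2)|
    set D : ℝ := 1 / (n + 2)
    refine (pow_le_pow_left₀ (abs_nonneg _) h3 2).trans ?_
    nlinarith [sq_nonneg (A - a), sq_nonneg (A - D), sq_nonneg (a - D)]
  have h5 : (1 / ((n : ℝ) + 2)) ≤ 1 / (n + 1) :=
    one_div_le_one_div_of_le (by positivity) (by linarith)
  have h6 : (1 / ((n : ℝ) + 2)) ^ 2 ≤ 1 / (n + 1) := by
    refine le_trans ?_ h5
    rw [sq]
    refine mul_le_of_le_one_left (by positivity) ?_
    rw [div_le_one hn2]
    linarith
  have h7 : 1 / (2 * ((n : ℝ) + 2)) = 1 / 2 * (1 / (n + 2)) := by field_simp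
  have h8 : 0 ≤ 1 / ((n : ℝ) + 1) := by positivity
  have e2 : 52 / μ ^ 2 * (n - μ) ^ 2 = 52 * ((n - μ) ^ 2 / μ ^ 2) := by ring
  have e3 : 24 / μ ^ 2 * z ^ 2 = 24 * (z ^ 2 / μ ^ 2) := by ring
  have e4 : 14 / μ = 7 * (2 / μ) := by ring
  rw [h7, e2, e3, e4]
  -- The coefficient 1/2 + 6 of 1/(n+1) is rounded up to 7, giving 14 = 7·2 and 52 = 7·4 + 6·4; also
  -- 24 = 6·4.
  linarith

/-! ### The general contextual bound -/

/-- The constant in the bound of the `L₁` error, for contextual parameters `Bᵢ ≤ b` and a constant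
`M ≥ κ` with `N ≤ M ‖·‖_∞`. -/
noncomputable def errorConstant (d : ℕ) (L κ b M : ℝ) : ℝ :=
  (1 + (1 - b)⁻¹ ^ 2 * (90 / (κ / M) ^ d + 6 * (L * κ) ^ 2)) / 2

section

variable {d t : ℕ} (N : Seminorm ℝ (Fin d → ℝ)) {L κ b M : ℝ} {f : Cube d → ℝ}
  {B : Fin t → ℝ}

/-- A pointwise bound, valid for every sample: the posterior enters only through two sums over
independent experiments, whose squares can then be averaged. -/
lemma l1Error_contextualSmoothBetaProcess_le (hκ : 0 < κ) (hb : 0 ≤ b)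
    (hb1 : b < 1) (hf : ∀ x, f x ∈ Set.Icc (0 : ℝ) 1) (hL : IsLipschitz N L f)
    (hB : ∀ i, 0 ≤ B i ∧ B i ≤ b) {r μ : ℝ} (hr : 0 < r) (hμ : 0 < μ)
    (S : Fin t → Cube d × Bool) (x : Cube d) :
    l1Error (contextualSmoothBetaProcess N κ (fun _ => 1) (fun _ => 1) B S x) (f x) ≤
      ENNReal.ofReal ((1 / r + r * ((1 - b)⁻¹ ^ 2 *
        (14 / μ + 6 * (|L| * kernelWidth κ d t) ^ 2 +
          52 / μ ^ 2 * (∑ i, (if normDist N x (S i).1 ≤ kernelWidth κ d t then 1 else 0) - μ) ^ 2 +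
          24 / μ ^ 2 * (∑ i, if normDist N x (S i).1 ≤ kernelWidth κ d t then
            (if (S i).2 = true then 1 else 0) - successProb (B i) (f (S i).1) else 0) ^ 2))) / 2)
      := by
  have hΔ : 0 ≤ kernelWidth κ d t := mul_nonneg hκ.le (Real.rpow_nonneg (Nat.cast_nonneg _) _)
  set Δ := kernelWidth κ d t
  set T := neighbours N Δ (fun i => (S i).1) x with hT
  have hs : (T.filter fun i => (S i).2 = true).card ≤ T.card := Finset.card_filter_le _ _
  have hmean := mean_mem_Icc T hb hB
  have hfT : ∀ i ∈ T, |f (S i).1 - f x| ≤ |L| * Δ := by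
    intro i hi
    have hi' : normDist N x (S i).1 ≤ Δ := (Finset.mem_filter.1 hi).2
    rw [abs_sub_comm]
    refine (hL _ _).trans ?_
    exact mul_le_mul (le_abs_self L) hi' (normDist_nonneg N _ _) (abs_nonneg L)
  have hcard : ∑ i, (if normDist N x (S i).1 ≤ Δ then (1 : ℝ) else 0) = T.card := by
    rw [hT, neighbours, Finset.sum_boole]
  have hz : (∑ i, if normDist N x (S i).1 ≤ Δ then
      (if (S i).2 = true then 1 else 0) - successProb (B i) (f (S i).1) else 0) =
      ((T.filter fun i => (S i).2 = true).card : ℝ) -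
        ∑ i ∈ T, successProb (B i) (f (S i).1) := by
    rw [← Finset.sum_filter, Finset.sum_sub_distrib, Finset.sum_boole]
    rfl
  rw [hcard, hz]
  refine (l1Error_contextPosterior_le hmean.1 hmean.2 hb1 hs (hf x) hr).trans
    (ENNReal.ofReal_le_ofReal ?_)
  have key := posterior_sq_error_le (q := successProb ((∑ i ∈ T, B i) / T.card) (f x))
    (z := ((T.filter fun i => (S i).2 = true).card : ℝ) - ∑ i ∈ T, successProb (B i) (f (S i).1))
    (n := T.card) (s := (T.filter fun i => (S i).2 = true).card) hμ
    (mul_nonneg (abs_nonneg L) hΔ) ?_ ?_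
  · gcongr
  · have hs' : ((T.filter fun i => (S i).2 = true).card : ℝ) ≤ T.card := Nat.cast_le.2 hs
    have hq : ∀ i, successProb (B i) (f (S i).1) ∈ Set.Icc (0 : ℝ) 1 := fun i =>
      successProb_mem_Icc ⟨(hB i).1, (hB i).2.trans hb1.le⟩ (hf _)
    have h1 : ∑ i ∈ T, successProb (B i) (f (S i).1) ≤ T.card := by
      simpa using Finset.sum_le_card_nsmul T _ 1 fun i _ => (hq i).2
    have h2 : 0 ≤ ∑ i ∈ T, successProb (B i) (f (S i).1) :=
      Finset.sum_nonneg fun i _ => (hq i).1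
    rw [abs_le]
    constructor <;> linarith [(T.filter fun i => (S i).2 = true).card.cast_nonneg (α := ℝ)]
  · convert abs_sum_successProb_sub_le T hb hb1 hB (hf x) hfT using 2
    ring

variable {Z : Type*} [MeasurableSpace Z]

/-- The number of the points with `ρ ≤ Δ` and the centered number of the successes there have variance
at most `t vol {ρ ≤ Δ}`. Each experiment observes a point `X z` of the cube, where `z` has law `ζ i` and
`X z` is uniform, and the outcome is Bernoulli with parameter `p i z`, whose conditional
expectation given `X z` is `q i (X z)`. -/
lemma integral_sq_counts_le {X : Z → Cube d} (hXm : Measurable X) (ζ : Fin t → Measure Z)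
    [∀ i, IsProbabilityMeasure (ζ i)] (hX : ∀ i, MeasurePreserving X (ζ i) volume)
    {p : Fin t → Z → ℝ} (hp : ∀ i, Measurable (p i))
    (hp01 : ∀ i, ∀ᵐ z ∂(ζ i), p i z ∈ Set.Icc (0 : ℝ) 1)
    {q : Fin t → Cube d → ℝ} (hq : ∀ i, Measurable (q i)) (hq01 : ∀ i y, q i y ∈ Set.Icc (0 : ℝ) 1)
    {ρ : Cube d → ℝ} (hρ : Measurable ρ) (Δ : ℝ)
    (hmean : ∀ i, ∫ z in X ⁻¹' {y | ρ y ≤ Δ}, (p i z - q i (X z)) ∂(ζ i) = 0) :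
    (Integrable (fun S : Fin t → Z × Bool =>
        (∑ i, (if ρ (X (S i).1) ≤ Δ then (1 : ℝ) else 0) - t * volume.real {y | ρ y ≤ Δ}) ^ 2)
        (Measure.pi fun i => testLaw (ζ i) (p i)) ∧
      ∫ S : Fin t → Z × Bool, (∑ i, (if ρ (X (S i).1) ≤ Δ then (1 : ℝ) else 0) -
        t * volume.real {y | ρ y ≤ Δ}) ^ 2 ∂(Measure.pi fun i => testLaw (ζ i) (p i)) ≤ t * volume.real {y | ρ y ≤ Δ}) ∧
    (Integrable (fun S : Fin t → Z × Bool => (∑ i, if ρ (X (S i).1) ≤ Δ then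
        (if (S i).2 = true then (1 : ℝ) else 0) - q i (X (S i).1) else 0) ^ 2)
        (Measure.pi fun i => testLaw (ζ i) (p i)) ∧
      ∫ S : Fin t → Z × Bool, (∑ i, if ρ (X (S i).1) ≤ Δ then
        (if (S i).2 = true then (1 : ℝ) else 0) - q i (X (S i).1) else 0) ^ 2
        ∂(Measure.pi fun i => testLaw (ζ i) (p i)) ≤ t * volume.real {y | ρ y ≤ Δ}) := by
  set A : Set (Cube d) := {y | ρ y ≤ Δ} with hAdef
  have hA : MeasurableSet A := measurableSet_le hρ measurable_const
  set v : ℝ := volume.real {y | ρ y ≤ Δ} with hv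
  have hprob : ∀ i, IsProbabilityMeasure (testLaw (ζ i) (p i)) := fun i =>
    isProbabilityMeasure_testLaw (hp i) (hp01 i)
  set g : Z × Bool → ℝ := fun w => if ρ (X w.1) ≤ Δ then 1 else 0 with hg
  set h : Fin t → Z × Bool → ℝ := fun i w => if ρ (X w.1) ≤ Δ then
    (if w.2 = true then 1 else 0) - q i (X w.1) else 0 with hh
  have hset : MeasurableSet {w : Z × Bool | ρ (X w.1) ≤ Δ} := (hXm.comp measurable_fst) hA
  have hset2 : MeasurableSet {w : Z × Bool | w.2 = true} :=
    measurable_snd (measurableSet_singleton true)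
  have hgm : Measurable g := Measurable.ite hset measurable_const measurable_const
  have hhm : ∀ i, Measurable (h i) := fun i =>
    Measurable.ite hset ((Measurable.ite hset2 measurable_const measurable_const).sub
      ((hq i).comp (hXm.comp measurable_fst))) measurable_const
  have hg01 : ∀ w, ‖g w‖ ≤ 1 := fun w => by
    simp only [hg]; split_ifs <;> simp
  have hhg : ∀ i w, |h i w| ≤ g w := fun i w => by
    have := hq01 i (X w.1)
    simp only [hh, hg]
    split_ifs
    · rw [abs_le]; constructor <;> linarith [this.1, this.2]
    · rw [abs_le]; constructor <;> linarith [this.1, this.2]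
    · simp
  have hgL : ∀ i, MemLp g 2 (testLaw (ζ i) (p i)) := fun i =>
    MemLp.of_bound hgm.aestronglyMeasurable 1 (Filter.Eventually.of_forall hg01)
  have hhL : ∀ i, MemLp (h i) 2 (testLaw (ζ i) (p i)) := fun i =>
    MemLp.of_bound (hhm i).aestronglyMeasurable 1 (Filter.Eventually.of_forall fun w =>
      (hhg i w).trans ((le_abs_self _).trans (hg01 w)))
  have hgint : ∀ i, ∫ w, g w ∂(testLaw (ζ i) (p i)) = v := fun i => by
    rw [integral_testLaw (hp i) (hp01 i) ((hgL i).integrable (by norm_num))]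
    calc _ = ∫ z, (X ⁻¹' A).indicator (fun _ => (1 : ℝ)) z ∂(ζ i) := by
          congr 1 with z
          simp only [hg, Set.indicator, Set.mem_preimage, hAdef, Set.mem_ofPred_eq]
          split_ifs <;> ring
      _ = (ζ i).real (X ⁻¹' A) := by
          rw [integral_indicator (hXm hA)]; simp
      _ = v := (hX i).measureReal_preimage hA.nullMeasurableSet
  have hhint : ∀ i, ∫ w, h i w ∂(testLaw (ζ i) (p i)) = 0 := fun i => by
    rw [integral_testLaw (hp i) (hp01 i) ((hhL i).integrable (by norm_num)), ← hmean i,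
      ← integral_indicator (hXm hA)]
    congr 1 with z
    simp only [hh, Set.indicator, Set.mem_preimage, hAdef, Set.mem_ofPred_eq, if_true, Bool.false_eq_true, if_false]
    split_ifs <;> ring
  have hg2 : ∀ i, ∫ w, g w ^ 2 ∂(testLaw (ζ i) (p i)) = v := fun i => by
    rw [← hgint i]
    congr 1 with w
    simp only [hg]
    split_ifs <;> simp
  have hh2 : ∀ i, ∫ w, h i w ^ 2 ∂(testLaw (ζ i) (p i)) ≤ v := fun i => by
    rw [← hg2 i]
    refine integral_mono (hhL i).integrable_sq (hgL i).integrable_sq fun w => ?_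
    exact sq_le_sq.2 ((hhg i w).trans (le_abs_self _))
  constructor
  · have := integral_sq_sum_sub_pi_le (fun i => testLaw (ζ i) (p i)) hgL
    simpa only [hgint, hg2, Finset.sum_const, Finset.card_univ, Fintype.card_fin,
      nsmul_eq_mul] using this
  · have := integral_sq_sum_sub_pi_le (fun i => testLaw (ζ i) (p i)) hhL
    simp only [hhint, Finset.sum_const_zero, sub_zero] at this
    refine ⟨this.1, this.2.trans ?_⟩
    simpa using Finset.sum_le_card_nsmul Finset.univ _ v fun i _ => hh2 i

lemma lintegral_quadratic_le {Ω : Type*} [MeasurableSpace Ω] {P : Measure Ω}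
    [IsProbabilityMeasure P] {u w : Ω → ℝ} (hu : Integrable (fun ω => u ω ^ 2) P)
    (hw : Integrable (fun ω => w ω ^ 2) P) {r k c₀ c₁ c₂ μ : ℝ} (hr : 0 < r) (hk : 0 ≤ k)
    (h₀ : 0 ≤ c₀) (h₁ : 0 ≤ c₁) (h₂ : 0 ≤ c₂) (huμ : ∫ ω, u ω ^ 2 ∂P ≤ μ)
    (hwμ : ∫ ω, w ω ^ 2 ∂P ≤ μ) :
    ∫⁻ ω, ENNReal.ofReal ((1 / r + r * (k * (c₀ + c₁ * u ω ^ 2 + c₂ * w ω ^ 2))) / 2) ∂P ≤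
      ENNReal.ofReal ((1 / r + r * (k * (c₀ + c₁ * μ + c₂ * μ))) / 2) := by
  have hi₁ : Integrable (fun ω => c₀ + c₁ * u ω ^ 2) P :=
    (integrable_const _).add (hu.const_mul _)
  have hi : Integrable (fun ω => c₀ + c₁ * u ω ^ 2 + c₂ * w ω ^ 2) P := hi₁.add (hw.const_mul _)
  have hj : Integrable (fun ω => (1 / r + r * (k * (c₀ + c₁ * u ω ^ 2 + c₂ * w ω ^ 2))) / 2) P :=
    ((integrable_const _).add ((hi.const_mul k).const_mul r)).div_const 2
  rw [← ofReal_integral_eq_lintegral_ofReal hj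
    (Filter.Eventually.of_forall fun ω => by simp only [Pi.zero_apply]; positivity)]
  refine ENNReal.ofReal_le_ofReal ?_
  rw [integral_div, integral_add (integrable_const _) ((hi.const_mul k).const_mul r),
    integral_const_mul, integral_const_mul, integral_add hi₁ (hw.const_mul _),
    integral_add (integrable_const _) (hu.const_mul _), integral_const_mul, integral_const_mul]
  simp only [integral_const, probReal_univ, one_smul]
  gcongr

/-- Each experiment observes a point `X z` of the cube, where `z` has law `ζ i`, `X z` is uniform,
and the outcome is Bernoulli with parameter `p i z`, whose conditional expectation given `X z` is
`(1 - Bᵢ) f (X z) + Bᵢ`. -/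
theorem lintegral_l1Error_contextual_le (hκ : 0 < κ) (hκM : κ ≤ M)
    (hNM : ∀ x y : Cube d, normDist N x y ≤ M * dist x y) (hb : 0 ≤ b) (hb1 : b < 1)
    (hf : ∀ x, f x ∈ Set.Icc (0 : ℝ) 1) (hL : IsLipschitz N L f) (ht : 1 ≤ t)
    (hB : ∀ i, 0 ≤ B i ∧ B i ≤ b) {X : Z → Cube d} (ζ : Fin t → Measure Z)
    [∀ i, IsProbabilityMeasure (ζ i)] (hX : ∀ i, MeasurePreserving X (ζ i) volume)
    {p : Fin t → Z → ℝ} (hp : ∀ i, Measurable (p i))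
    (hp01 : ∀ i, ∀ᵐ z ∂(ζ i), p i z ∈ Set.Icc (0 : ℝ) 1)
    (hmean : ∀ i, ∀ A : Set (Cube d), MeasurableSet A →
      ∫ z in X ⁻¹' A, (p i z - successProb (B i) (f (X z))) ∂(ζ i) = 0) (x : Cube d) :
    ∫⁻ S, l1Error (contextualSmoothBetaProcess N κ (fun _ => 1) (fun _ => 1) B
        (fun i => (X (S i).1, (S i).2)) x) (f x) ∂(Measure.pi fun i => testLaw (ζ i) (p i)) ≤
      ENNReal.ofReal (errorConstant d L κ b M * (t : ℝ) ^ (-(1 / ((d : ℝ) + 2)))) := by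
  have hM : 0 < M := hκ.trans_le hκM
  have ht0 : (0 : ℝ) < t := Nat.cast_pos.2 ht
  have hXm : Measurable X := (hX ⟨0, ht⟩).measurable
  set r : ℝ := (t : ℝ) ^ (1 / ((d : ℝ) + 2)) with hrdef
  have hr1 : 1 ≤ r := Real.one_le_rpow (Nat.one_le_cast.2 ht) (by positivity)
  have hr : 0 < r := one_pos.trans_le hr1
  have hrt : r ^ (d + 2) = t := by
    rw [hrdef, ← Real.rpow_natCast, ← Real.rpow_mul ht0.le]
    push_cast
    rw [one_div_mul_cancel (by positivity), Real.rpow_one]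
  have hrneg : (t : ℝ) ^ (-(1 / ((d : ℝ) + 2))) = 1 / r := by
    rw [Real.rpow_neg ht0.le, one_div r]
  have hΔ : kernelWidth κ d t = κ / r := by rw [kernelWidth, hrneg, mul_one_div]
  set Δ := kernelWidth κ d t with hΔdef
  have hΔ0 : 0 ≤ Δ := by rw [hΔ]; positivity
  have hΔM : Δ ≤ M := by rw [hΔ]; exact (div_le_self hκ.le hr1).trans hκM
  set A : Set (Cube d) := {y | normDist N x y ≤ Δ} with hA
  have hAm : MeasurableSet A := measurableSet_normDist_le N x Δ
  set c : ℝ := (κ / M) ^ d with hc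
  have hc0 : 0 < c := by positivity
  set v : ℝ := volume.real A with hv
  have hv1 : c / r ^ d ≤ v := by
    refine le_trans (le_of_eq ?_) (pow_le_volume_normDist_le hM hNM x hΔ0 hΔM)
    rw [hΔ, hc, ← div_pow]
    congr 1
    field_simp
  set μ : ℝ := t * v with hμdef
  -- Since t = r^(d+2), the expected number of neighbours is at least t·c/r^d = c r².
  have hμ1 : c * r ^ 2 ≤ μ := by
    calc c * r ^ 2 = t * (c / r ^ d) := by rw [← hrt, pow_add]; field_simp
      _ ≤ μ := mul_le_mul_of_nonneg_left hv1 ht0.le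
  have hμ : 0 < μ := lt_of_lt_of_le (by positivity) hμ1
  have hprob : ∀ i, IsProbabilityMeasure (testLaw (ζ i) (p i)) := fun i =>
    isProbabilityMeasure_testLaw (hp i) (hp01 i)
  have hfm : Measurable f := hL.continuous.measurable
  have hq01 : ∀ i y, successProb (B i) (f y) ∈ Set.Icc (0 : ℝ) 1 := fun i y =>
    successProb_mem_Icc ⟨(hB i).1, (hB i).2.trans hb1.le⟩ (hf y)
  have hqm : ∀ i, Measurable fun y => successProb (B i) (f y) := fun i => by
    unfold successProb; fun_prop
  obtain ⟨⟨hI1, hE1⟩, hI2, hE2⟩ := integral_sq_counts_le hXm ζ hX hp hp01 hqm hq01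
    (continuous_normDist N x).measurable Δ fun i => hmean i A hAm
  refine (lintegral_mono fun S =>
    l1Error_contextualSmoothBetaProcess_le N hκ hb hb1 hf hL hB hr hμ _ x).trans ?_
  refine (lintegral_quadratic_le hI1 hI2 hr (sq_nonneg (1 - b)⁻¹)
    (c₀ := 14 / μ + 6 * (|L| * Δ) ^ 2) (c₁ := 52 / μ ^ 2) (c₂ := 24 / μ ^ 2)
    (by positivity) (by positivity) (by positivity) hE1 hE2).trans ?_
  refine ENNReal.ofReal_le_ofReal ?_
  rw [hrneg, errorConstant, ← hc]
  -- Both second moments are at most μ, so all three terms are of order 1/μ; this is the 90 in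
  -- `errorConstant`.
  have h3 : 52 / μ ^ 2 * μ + 24 / μ ^ 2 * μ + 14 / μ = 90 / μ := by field_simp; ring
  have h4 : 90 / μ ≤ 90 / (c * r ^ 2) :=
    div_le_div_of_nonneg_left (by norm_num) (by positivity) hμ1
  have h5 : (|L| * Δ) ^ 2 = (L * κ) ^ 2 / r ^ 2 := by
    rw [hΔ, mul_pow, div_pow, sq_abs]; ring
  have h6 : 14 / μ + 6 * (|L| * Δ) ^ 2 + 52 / μ ^ 2 * μ + 24 / μ ^ 2 * μ ≤
      (90 / c + 6 * (L * κ) ^ 2) / r ^ 2 := by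
    have : (90 / c + 6 * (L * κ) ^ 2) / r ^ 2 =
        90 / (c * r ^ 2) + 6 * ((L * κ) ^ 2 / r ^ 2) := by field_simp
    rw [this, h5]
    linarith
  calc _ ≤ (1 / r + r * ((1 - b)⁻¹ ^ 2 * ((90 / c + 6 * (L * κ) ^ 2) / r ^ 2))) / 2 := by
        gcongr
    _ = _ := by field_simp

end

/-! ### The three settings as instances of the general bound -/

section

variable {d t : ℕ} (N : Seminorm ℝ (Fin d → ℝ)) {L κ b M : ℝ} {f : Cube d → ℝ}

/-- Without neighbours the mean is 0 rather than B, but then n = s = 0 and B occurs only as B^0. -/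
lemma constantContextProcess_eq_contextual (B : ℝ) (S : Fin t → Cube d × Bool) (x : Cube d) :
    constantContextProcess N κ (fun _ => 1) (fun _ => 1) B S x =
      contextualSmoothBetaProcess N κ (fun _ => 1) (fun _ => 1) (fun _ => B) S x := by
  unfold constantContextProcess contextualSmoothBetaProcess
  simp only
  set T := neighbours N (kernelWidth κ d t) (fun i => (S i).1) x
  rcases T.eq_empty_or_nonempty with h | h
  · rw [h]
    simp [contextPosterior, mixtureWeight]
  · have : (T.card : ℝ) ≠ 0 := Nat.cast_ne_zero.2 h.card_ne_zero
    rw [Finset.sum_const, nsmul_eq_mul, mul_div_cancel_left₀ _ this]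

/-- Because 0^0 = 1 and other powers of 0 vanish, only the component i = s survives. -/
lemma contextPosterior_zero {n s : ℕ} (hs : s ≤ n) :
    contextPosterior 1 1 0 n s = betaMeasure (1 + s) (1 + n - s) := by
  have hw : ∀ i ∈ Finset.range (s + 1), i ≠ s → mixtureWeight 1 1 0 n s i = 0 := by
    intro i hi his
    have : s - i ≠ 0 := by
      have := Finset.mem_range.1 hi
      omega
    simp [mixtureWeight, this]
  have hpos : mixtureWeight 1 1 0 n s s ≠ 0 := by
    have h1 : 0 < Real.Gamma (1 + s) := Real.Gamma_pos_of_pos (by positivity)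
    have h2 : 0 < Real.Gamma (1 + n - s) := Real.Gamma_pos_of_pos (by
      have : (s : ℝ) ≤ n := Nat.cast_le.2 hs
      linarith)
    simp [mixtureWeight, h1.ne', h2.ne']
  rw [contextPosterior, Finset.sum_eq_single s hw (by simp),
    Finset.sum_eq_single s (fun i hi his => by simp [hw i hi his]) (by simp),
    div_self hpos]
  simp

lemma smoothBetaProcess_eq_constantContext (S : Fin t → Cube d × Bool) (x : Cube d) :
    smoothBetaProcess N κ (fun _ => 1) (fun _ => 1) S x =
      constantContextProcess N κ (fun _ => 1) (fun _ => 1) 0 S x := by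
  unfold smoothBetaProcess constantContextProcess
  simp only
  set T := neighbours N (kernelWidth κ d t) (fun i => (S i).1) x with hT
  have hcount : ∀ β : Bool, ∑ i, (if (S i).2 = β then
      sharingKernel N (kernelWidth κ d t) x (S i).1 else 0) =
      ((T.filter fun i => (S i).2 = β).card : ℝ) := by
    intro β
    rw [hT, neighbours, Finset.filter_filter, ← Finset.sum_boole]
    refine Finset.sum_congr rfl fun i _ => ?_
    unfold sharingKernel
    split_ifs <;> simp_all
  have hsum : (T.filter fun i => (S i).2 = true).card + (T.filter fun i => (S i).2 = false).card =
      T.card := by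
    simpa using Finset.card_filter_add_card_filter_not (s := T) fun i => (S i).2 = true
  rw [contextPosterior_zero (Finset.card_filter_le _ _), hcount, hcount, ← hsum]
  push_cast
  congr 1
  ring

theorem lintegral_l1Error_constant_le {B : ℝ} (hκ : 0 < κ) (hκM : κ ≤ M)
    (hNM : ∀ x y : Cube d, normDist N x y ≤ M * dist x y) (hB : 0 ≤ B) (hB1 : B < 1)
    (hf : ∀ x, f x ∈ Set.Icc (0 : ℝ) 1) (hL : IsLipschitz N L f) (ht : 1 ≤ t) (x : Cube d) :
    ∫⁻ S, l1Error (constantContextProcess N κ (fun _ => 1) (fun _ => 1) B S x) (f x)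
        ∂(contextLaw f B t) ≤
      ENNReal.ofReal (errorConstant d L κ B M * (t : ℝ) ^ (-(1 / ((d : ℝ) + 2)))) := by
  simp_rw [constantContextProcess_eq_contextual]
  have hfm : Measurable f := hL.continuous.measurable
  exact lintegral_l1Error_contextual_le N hκ hκM hNM hB hB1 hf hL ht (fun _ => ⟨hB, le_rfl⟩)
    (X := id) (fun _ => volume) (fun _ => MeasurePreserving.id _)
    (p := fun _ x => (1 - B) * f x + B) (fun _ => by fun_prop)
    (fun _ => Filter.Eventually.of_forall fun y => successProb_mem_Icc ⟨hB, hB1.le⟩ (hf y))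
    (fun _ A _ => by simp [successProb]) x

theorem lintegral_l1Error_static_le (hκ : 0 < κ) (hκM : κ ≤ M)
    (hNM : ∀ x y : Cube d, normDist N x y ≤ M * dist x y)
    (hf : ∀ x, f x ∈ Set.Icc (0 : ℝ) 1) (hL : IsLipschitz N L f) (ht : 1 ≤ t) (x : Cube d) :
    ∫⁻ S, l1Error (smoothBetaProcess N κ (fun _ => 1) (fun _ => 1) S x) (f x)
        ∂(staticLaw f t) ≤
      ENNReal.ofReal (errorConstant d L κ 0 M * (t : ℝ) ^ (-(1 / ((d : ℝ) + 2)))) := by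
  have hlaw : staticLaw f t = contextLaw f 0 t := by simp [staticLaw, contextLaw]
  simp_rw [smoothBetaProcess_eq_constantContext, hlaw]
  exact lintegral_l1Error_constant_le N hκ hκM hNM le_rfl one_pos hf hL ht x

/-- The integrand is (1 - f x)·e on A, a product of a function of the point and the independent
mean-zero noise. -/
lemma setIntegral_noisyParam_sub (f : Cube d → ℝ) (B : ℝ) {ρ : Measure ℝ} [IsProbabilityMeasure ρ] (hρ : ∫ e, e ∂ρ = 0)
    {A : Set (Cube d)} (hA : MeasurableSet A) :
    ∫ z in Prod.fst ⁻¹' A, (noisyParam f B z.2 z.1 - successProb B (f z.1))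
      ∂((volume : Measure (Cube d)).prod ρ) = 0 := by
  have h : ∀ z : Cube d × ℝ, (Prod.fst ⁻¹' A).indicator
      (fun z => noisyParam f B z.2 z.1 - successProb B (f z.1)) z =
      A.indicator (fun x => 1 - f x) z.1 * z.2 := fun z => by
    by_cases hz : z.1 ∈ A
    · rw [Set.indicator_of_mem (by exact hz), Set.indicator_of_mem hz]
      unfold noisyParam successProb; ring
    · rw [Set.indicator_of_notMem (by exact hz), Set.indicator_of_notMem hz, zero_mul]
  rw [← integral_indicator (measurable_fst hA)]
  simp_rw [h]
  rw [integral_prod_mul (A.indicator fun x => 1 - f x) fun e => e, hρ, mul_zero]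

theorem lintegral_l1Error_noisy_le {B : Fin t → ℝ} (hκ : 0 < κ) (hκM : κ ≤ M)
    (hNM : ∀ x y : Cube d, normDist N x y ≤ M * dist x y) (hb : 0 ≤ b) (hb1 : b < 1)
    (hf : ∀ x, f x ∈ Set.Icc (0 : ℝ) 1) (hL : IsLipschitz N L f) (ht : 1 ≤ t)
    (hB : ∀ i, 0 ≤ B i ∧ B i ≤ b) (ρ : Fin t → Measure ℝ) [∀ i, IsProbabilityMeasure (ρ i)]
    (hρ : ∀ i, ∫ e, e ∂(ρ i) = 0)
    (hρ01 : ∀ i, ∀ᵐ e ∂(ρ i), ∀ x, noisyParam f (B i) e x ∈ Set.Icc (0 : ℝ) 1) (x : Cube d) :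
    ∫⁻ S, l1Error (contextualSmoothBetaProcess N κ (fun _ => 1) (fun _ => 1) B
        (fun i => ((S i).1.1, (S i).2)) x) (f x) ∂(noisyLaw f B ρ) ≤
      ENNReal.ofReal (errorConstant d L κ b M * (t : ℝ) ^ (-(1 / ((d : ℝ) + 2)))) := by
  have hfm : Measurable f := hL.continuous.measurable
  refine lintegral_l1Error_contextual_le N hκ hκM hNM hb hb1 hf hL ht hB (X := Prod.fst)
    (fun i => (volume : Measure (Cube d)).prod (ρ i)) (fun i => measurePreserving_fst)
    (p := fun i z => noisyParam f (B i) z.2 z.1) (fun i => by unfold noisyParam; fun_prop)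
    (fun i => ?_) (fun i A hA => setIntegral_noisyParam_sub f (B i) (hρ i) hA) x
  have h := (Measure.quasiMeasurePreserving_snd (μ := (volume : Measure (Cube d)))
    (ν := ρ i)).ae (hρ01 i)
  filter_upwards [h] with z hz using hz z.1

end

end SmoothBeta

theorem mainTheorem8 (d : ℕ) (N : Seminorm ℝ (Fin d → ℝ)) (hN : ∀ v, N v = 0 → v = 0)
    (L κ : ℝ) (hκ : 0 < κ) :
    -- static setting, Smooth Beta Process
    (∃ C : ℝ, ∀ f : SmoothBeta.Cube d → ℝ, (∀ x, f x ∈ Set.Icc (0 : ℝ) 1) →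
      SmoothBeta.IsLipschitz N L f → ∀ t : ℕ, 1 ≤ t →
        (⨆ x : SmoothBeta.Cube d, ∫⁻ S,
            SmoothBeta.l1Error
              (SmoothBeta.smoothBetaProcess N κ (fun _ => 1) (fun _ => 1) S x) (f x)
            ∂(SmoothBeta.staticLaw f t)) ≤
          ENNReal.ofReal (C * (t : ℝ) ^ (-(1 / ((d : ℝ) + 2))))) ∧
    -- dynamic setting, constant contextual parameters
    (∀ B : ℝ, 0 ≤ B → B < 1 →
      ∃ C : ℝ, ∀ f : SmoothBeta.Cube d → ℝ, (∀ x, f x ∈ Set.Ioc (0 : ℝ) 1) →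
        SmoothBeta.IsLipschitz N L f → ∀ t : ℕ, 1 ≤ t →
          (⨆ x : SmoothBeta.Cube d, ∫⁻ S,
              SmoothBeta.l1Error
                (SmoothBeta.constantContextProcess N κ (fun _ => 1) (fun _ => 1) B S x) (f x)
              ∂(SmoothBeta.contextLaw f B t)) ≤
            ENNReal.ofReal (C * (t : ℝ) ^ (-(1 / ((d : ℝ) + 2))))) ∧
    -- dynamic setting, varying and noisy contextual parameters
    (∀ b σ : ℝ, 0 ≤ b → b < 1 →
      ∃ C : ℝ, ∀ f : SmoothBeta.Cube d → ℝ, (∀ x, f x ∈ Set.Ioc (0 : ℝ) 1) →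
        SmoothBeta.IsLipschitz N L f → ∀ t : ℕ, 1 ≤ t →
          ∀ B : Fin t → ℝ, (∀ i, 0 ≤ B i ∧ B i ≤ b) →
          ∀ ρ : Fin t → Measure ℝ, (∀ i, IsProbabilityMeasure (ρ i)) →
            (∀ i, MemLp id 2 (ρ i)) →
            (∀ i, ∫ e, e ∂(ρ i) = 0) →
            (∀ i, ProbabilityTheory.variance id (ρ i) = σ ^ 2) →
            (∀ i, ∀ᵐ e ∂(ρ i), ∀ x,
              SmoothBeta.noisyParam f (B i) e x ∈ Set.Icc (0 : ℝ) 1) →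
            (⨆ x : SmoothBeta.Cube d, ∫⁻ S,
                SmoothBeta.l1Error
                  (SmoothBeta.contextualSmoothBetaProcess N κ (fun _ => 1) (fun _ => 1) B
                    (fun i => ((S i).1.1, (S i).2)) x) (f x)
                ∂(SmoothBeta.noisyLaw f B ρ)) ≤
              ENNReal.ofReal (C * (t : ℝ) ^ (-(1 / ((d : ℝ) + 2))))) := by
  obtain ⟨M₀, hM₀, hNM₀⟩ := SmoothBeta.exists_normDist_le N
  -- Enlarging M₀ to at least κ ensures Δ ≤ κ ≤ M for all t ≥ 1. As M depends only on the norm and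
  -- κ, the constants are uniform in f and t.
  obtain ⟨M, hκM, hNM⟩ : ∃ M, κ ≤ M ∧
      ∀ x y : SmoothBeta.Cube d, SmoothBeta.normDist N x y ≤ M * dist x y :=
    ⟨max κ M₀, le_max_left _ _, fun x y => (hNM₀ x y).trans
      (mul_le_mul_of_nonneg_right (le_max_right _ _) dist_nonneg)⟩
  refine ⟨⟨SmoothBeta.errorConstant d L κ 0 M, fun f hf hL t ht => iSup_le fun x => ?_⟩,
    fun B hB hB1 => ⟨SmoothBeta.errorConstant d L κ B M, fun f hf hL t ht => iSup_le fun x => ?_⟩,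
    fun b σ hb hb1 => ⟨SmoothBeta.errorConstant d L κ b M,
      fun f hf hL t ht B hB ρ hρ _ hmean _ h01 => iSup_le fun x => ?_⟩⟩
  · exact SmoothBeta.lintegral_l1Error_static_le N hκ hκM hNM hf hL ht x
  · exact SmoothBeta.lintegral_l1Error_constant_le N hκ hκM hNM hB hB1
      (fun y => Set.Ioc_subset_Icc_self (hf y)) hL ht x
  · exact SmoothBeta.lintegral_l1Error_noisy_le N hκ hκM hNM hb hb1
      (fun y => Set.Ioc_subset_Icc_self (hf y)) hL ht hB ρ hmean h01 x
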